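/- **Setting.** Let $M$ be a paracompact (Hausdorff) $C^\infty$ manifold of finite dimension; all objects below are $C^\infty$. A vector $1$-form is a $(1,1)$-tensor field, viewed as a field of endomorphisms of $TM$; $[\cdot,\cdot]$ is the Frölicher–Nijenhuis bracket. Thus for vector fields $X,Y$ and vector $1$-forms $K,N$ it is the Lie bracket $[X,Y]$, and $$[X,K]Y=[X,KY]-K[X,Y],\qquad [K,X]=-[X,K],$$ $$[K,N](X,Y)=[KX,NY]+[NX,KY]+KN[X,Y]+NK[X,Y]-K[NX,Y]-K[X,NY]-N[KX,Y]-N[X,KY].$$ Let $L$ be a vector $1$-form on $M$ of constant rank $n\ge 1$ with $[L,L]=0$ and $\operatorname{Im}L_z=\operatorname{Ker}L_z$ for all $z\in M$ (so $\dim M=2n$), and let $C$ be a vector field on $M$ (the canonical vector field) such that around every point of $M$ there are local coordinates $(x^1,\dots,x^n,y^1,\dots,y^n)$ with $$L\frac{\partial}{\partial x^i}=\frac{\partial}{\partial y^i},\qquad L\frac{\partial}{\partial y^i}=0,\qquad C=\sum_i y^i\frac{\partial}{\partial y^i}.$$ **Definitions.** An *$L$-semispray* is a vector field $S$ with $LS=C$.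 A vector $1$-form $K$ is *$L$-semibasic* if $LK=0$ and $KX=0$ for every vector field $X$ with $LX=0$; similarly a vector $2$-form $B$ is $L$-semibasic if $LB=0$ and $B(X,\cdot)=0$ for every vector field $X$ with $LX=0$. The *potential* of an $L$-semibasic vector form is $K^\circ=KS'$, respectively $B^\circ=B(S',\cdot)$, for any $L$-semispray $S'$ (it does not depend on $S'$). An *$L$-connection* is a vector $1$-form $\Gamma$ with $L\Gamma=L$ and $\Gamma L=-L$. Its *canonical $L$-semispray* is $\tfrac12(I+\Gamma)S'$, where $S'$ is any $L$-semispray. Its *torsion* is $T=\tfrac12[L,\Gamma]$, and its *strong torsion* is $T^\circ-\tfrac12[C,\Gamma]$. **Theorem 3 (Canonical decomposition theorem).** Let $S$ be an $L$-semispray on $M$ and let $t$ be an $L$-semibasic vector $1$-form on $M$ such that $t^\circ+[C,S]-S=0$. Then there exists one and only one $L$-connection $\Gamma$ on $M$ whose canonical $L$-semispray is $S$ and whose strong torsion is $t$. This $L$-connection is $$\Gamma=[L,S]+t .$$ -/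

import Mathlib

open scoped Manifold ContDiff
open Module VectorField

noncomputable section

namespace LConnection

section Basic

variable {E : Type*} [NormedAddCommGroup E] [NormedSpace ℝ E]
  {H : Type*} [TopologicalSpace H] (I : ModelWithCorners ℝ E H)
  (M : Type*) [TopologicalSpace M] [ChartedSpace H M] [IsManifold I ∞ M]

/-- The algebra of smooth real functions on `M`. -/
abbrev SmoothFun : Type _ := C^∞⟮I, M; 𝓘(ℝ, ℝ), ℝ⟯

/-- Smooth vector fields on `M`. -/
abbrev VField : Type _ := Cₛ^∞⟮I; E, (TangentSpace I : M → Type _)⟯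

variable {I M}

/-- A smooth function times a smooth vector field, pointwise. -/
instance : SMul (SmoothFun I M) (VField I M) where
  smul f X := ⟨fun z => f z • X z, f.contMDiff.smul_section X.contMDiff⟩

theorem smul_apply (f : SmoothFun I M) (X : VField I M) (z : M) : (f • X) z = f z • X z := rfl

theorem add_apply (X Y : VField I M) (z : M) : (X + Y) z = X z + Y z := rfl

theorem sum_apply {ι : Type*} (s : Finset ι) (X : ι → VField I M) (z : M) :
    (∑ i ∈ s, X i) z = ∑ i ∈ s, X i z := by
  have h := map_sum (ContMDiffSection.coeAddHom I E ∞ (TangentSpace I : M → Type _)) X s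
  exact (congrFun h z).trans (Finset.sum_apply z s _)

/-- Vector fields form a module over the smooth functions. -/
instance : Module (SmoothFun I M) (VField I M) where
  one_smul X := by ext z; exact one_smul ℝ (X z)
  mul_smul f g X := by ext z; exact mul_smul (f z) (g z) (X z)
  smul_zero f := by ext z; exact smul_zero (f z)
  smul_add f X Y := by ext z; exact smul_add (f z) (X z) (Y z)
  add_smul f g X := by ext z; exact add_smul (f z) (g z) (X z)
  zero_smul X := by ext z; exact zero_smul ℝ (X z)

instance : SMulCommClass (SmoothFun I M) ℝ (VField I M) where
  smul_comm f r X := by ext z; exact smul_comm (f z) r (X z)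

instance : SMulCommClass ℝ (SmoothFun I M) (VField I M) where
  smul_comm r f X := by ext z; exact smul_comm r (f z) (X z)

instance : IsScalarTower ℝ (SmoothFun I M) (VField I M) where
  smul_assoc r f X := by ext z; exact smul_assoc r (f z) (X z)

variable (I M)

/-- Vector 1-forms (smooth (1,1)-tensor fields), as the endomorphisms of the module of vector
fields over the smooth functions. Their pointwise values are given by `valueAt` below. -/
abbrev VForm1 : Type _ := Module.End (SmoothFun I M) (VField I M)

/-- Vector 2-forms: alternating maps of two vector fields, bilinear over the smooth functions,
with values in vector fields. -/
def VForm2 : Submodule (SmoothFun I M)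
    (VField I M →ₗ[SmoothFun I M] VField I M →ₗ[SmoothFun I M] VField I M) where
  carrier := {B | B.IsAlt}
  add_mem' hA hB := fun X => by simp [hA X, hB X]
  zero_mem' := fun X => rfl
  smul_mem' f B hB := fun X => by simp [hB X]

variable {I M}

section Pointwise

variable [FiniteDimensional ℝ E] [T2Space M]

/-- Near `z`, all vector fields are combinations of finitely many global ones. -/
theorem exists_frame (z : M) : ∃ (k : ℕ) (ρ : SmoothFun I M) (Y : Fin k → VField I M), ρ z = 1 ∧
    (∀ X : VField I M, ∃ c : Fin k → SmoothFun I M,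
      ρ • X = ∑ i, c i • Y i ∧ (X z = 0 → ∀ i, c i z = 0)) ∧
    ∀ v : TangentSpace I z, ∃ a : Fin k → ℝ, v = ∑ i, a i • Y i z := by
  let e := trivializationAt E (TangentSpace I : M → Type _) z
  have hz : z ∈ e.baseSet := FiberBundle.mem_baseSet_trivializationAt' z
  let b := finBasis ℝ E
  have hs : ∀ i, ContMDiffOn I (I.prod 𝓘(ℝ, E)) ∞
      (fun x => Bundle.TotalSpace.mk' E x (e.localFrame b i x)) e.baseSet :=
    fun i => e.contMDiffOn_localFrame_baseSet ∞ b i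
  obtain ⟨ρ, -, hρ⟩ := (SmoothBumpFunction.nhds_basis_tsupport (I := I) z).mem_iff.1
    (e.open_baseSet.mem_nhds hz)
  let r : SmoothFun I M := ⟨ρ, ρ.contMDiff⟩
  let Y : Fin (finrank ℝ E) → VField I M := fun i => ⟨(ρ : M → ℝ) • e.localFrame b i,
    ContMDiffOn.smul_section_of_tsupport ρ.contMDiff.contMDiffOn e.open_baseSet hρ (hs i)⟩
  have hYapp : ∀ i x, Y i x = ρ x • e.localFrame b i x := fun i x => rfl
  refine ⟨_, r * r, Y, ?_, fun X => ?_, fun v => ?_⟩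
  · change ρ z * ρ z = 1
    rw [ρ.eq_one, one_mul]
  · have hc : ∀ i, ContMDiff I 𝓘(ℝ, ℝ) ∞
        (fun x => ρ x * e.localFrameCoeff I b i x (X x)) := by
      intro i
      refine contMDiff_of_tsupport fun x hx => ?_
      have hx' : x ∈ e.baseSet := hρ (tsupport_mul_subset_left hx)
      exact ρ.contMDiffAt.mul (contMDiffAt_localFrameCoeff b hx' X.contMDiff.contMDiffAt i)
    let c : Fin (finrank ℝ E) → SmoothFun I M := fun i => ⟨_, hc i⟩
    refine ⟨c, ?_, ?_⟩
    · ext x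
      rw [sum_apply]
      change (ρ x * ρ x) • X x =
        ∑ i, (ρ x * e.localFrameCoeff I b i x (X x)) • (ρ x • e.localFrame b i x)
      by_cases hx : x ∈ e.baseSet
      · conv_lhs => rw [e.eq_sum_localFrameCoeff_smul (I := I) (b := b) (s := X) hx]
        rw [Finset.smul_sum]
        refine Finset.sum_congr rfl fun i _ => ?_
        rw [smul_smul, smul_smul]
        congr 1
        ring
      · have h0 : ρ x = 0 := image_eq_zero_of_notMem_tsupport fun h => hx (hρ h)
        simp [h0]
    · intro hX i
      change ρ z * e.localFrameCoeff I b i z (X z) = 0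
      rw [hX, map_zero, mul_zero]
  · refine ⟨fun i => e.localFrameCoeff I b i z v, ?_⟩
    simp only [hYapp, ρ.eq_one, one_smul]
    have h := e.eq_sum_localFrameCoeff_smul (I := I) (b := b) (s := FiberBundle.extend E v) hz
    rwa [FiberBundle.extend_apply_self] at h

/-- Every tangent vector is the value of a smooth vector field. -/
theorem exists_field_eq (z : M) (v : TangentSpace I z) : ∃ X : VField I M, X z = v := by
  obtain ⟨k, ρ, Y, -, -, h⟩ := exists_frame (I := I) z
  obtain ⟨a, rfl⟩ := h v
  exact ⟨∑ i, a i • Y i, sum_apply ..⟩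

/-- The value of `K X` at `z` only depends on the value of `X` at `z`. -/
theorem apply_congr (K : VForm1 I M) {X X' : VField I M} {z : M} (h : X z = X' z) :
    (K X) z = (K X') z := by
  obtain ⟨k, ρ, Y, hρ, hY, -⟩ := exists_frame (I := I) z
  obtain ⟨c, hc, hc0⟩ := hY (X - X')
  have h0 := hc0 (sub_eq_zero.2 h)
  have h1 : (K (ρ • (X - X'))) z = K X z - K X' z := by
    rw [map_smul, smul_apply, hρ, one_smul, map_sub]
    rfl
  rw [← sub_eq_zero, ← h1, hc, map_sum, sum_apply]
  refine Finset.sum_eq_zero fun i _ => ?_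
  rw [map_smul, smul_apply, h0 i, zero_smul]

/-- The value `K_z : T_z M → T_z M` of a vector 1-form `K`, determined by
`K_z (X z) = (K X) z`. -/
def valueAt (K : VForm1 I M) (z : M) : TangentSpace I z →ₗ[ℝ] TangentSpace I z where
  toFun v := K (exists_field_eq z v).choose z
  map_add' v w := by
    rw [← add_apply, ← map_add]
    refine apply_congr K ?_
    rw [(exists_field_eq z (v + w)).choose_spec, add_apply, (exists_field_eq z v).choose_spec,
      (exists_field_eq z w).choose_spec]
  map_smul' r v := by
    have hr : K (r • (exists_field_eq z v).choose) = r • K (exists_field_eq z v).choose :=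
      (K.restrictScalars ℝ).map_smul r _
    change _ = (r • K (exists_field_eq z v).choose) z
    rw [← hr]
    refine apply_congr K ?_
    rw [(exists_field_eq z (r • v)).choose_spec]
    change r • v = r • _
    rw [(exists_field_eq z v).choose_spec]

theorem valueAt_apply (K : VForm1 I M) (X : VField I M) (z : M) :
    valueAt K z (X z) = (K X) z :=
  apply_congr K (exists_field_eq z (X z)).choose_spec

end Pointwise

end Basic

section Brackets

variable {E : Type*} [NormedAddCommGroup E] [NormedSpace ℝ E] [FiniteDimensional ℝ E]
  {H : Type*} [TopologicalSpace H] {I : ModelWithCorners ℝ E H}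
  {M : Type*} [TopologicalSpace M] [ChartedSpace H M] [IsManifold I ∞ M]

/-- The Lie bracket `[X, Y]` of smooth vector fields. -/
def lie (X Y : VField I M) : VField I M where
  toFun := mlieBracket I X Y
  contMDiff_toFun := by
    have : CompleteSpace E := FiniteDimensional.complete ℝ E
    have h2 : IsManifold I 2 M := IsManifold.of_le (n := ∞) (by
      exact WithTop.coe_le_coe.2 (le_top : (2 : ℕ∞) ≤ ⊤))
    have : IsManifold I (minSmoothness ℝ 2) M := by
      simpa using h2
    have : IsManifold I (((⊤ : ℕ∞) : WithTop ℕ∞) + 1) M := by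
      simpa using (inferInstance : IsManifold I ∞ M)
    exact ContDiff.mlieBracket_vectorField (m := ⊤) (n := ⊤) X.contMDiff Y.contMDiff (by simp)

theorem lie_apply (X Y : VField I M) (z : M) : lie X Y z = mlieBracket I X Y z := rfl

theorem lie_swap (X Y : VField I M) : lie X Y = -lie Y X := by
  ext z
  exact mlieBracket_swap_apply

theorem lie_self (X : VField I M) : lie X X = 0 := by
  ext z
  simp [lie_apply]

theorem lie_add_right (X Y Y' : VField I M) : lie X (Y + Y') = lie X Y + lie X Y' := by
  have : CompleteSpace E := FiniteDimensional.complete ℝ E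
  ext z
  exact mlieBracket_add_right Y.mdifferentiableAt Y'.mdifferentiableAt

theorem lie_add_left (X X' Y : VField I M) : lie (X + X') Y = lie X Y + lie X' Y := by
  rw [lie_swap, lie_add_right, lie_swap Y X, lie_swap Y X']
  abel

/-- The derivative `X f` of a smooth function along a vector field. -/
def dirDeriv (X : VField I M) (f : SmoothFun I M) : SmoothFun I M where
  val z := mvfderiv I f z (X z)
  property := by
    have h1 : ContMDiff I.tangent (𝓘(ℝ, ℝ).tangent) ∞ (tangentMap I 𝓘(ℝ, ℝ) f) :=
      f.contMDiff.contMDiff_tangentMap (by simp)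
    have h2 := contMDiff_snd_tangentBundle_modelSpace ℝ 𝓘(ℝ, ℝ) (n := ∞)
    exact h2.comp (h1.comp X.contMDiff)

theorem lie_smul_right (f : SmoothFun I M) (X Y : VField I M) :
    lie X (f • Y) = dirDeriv X f • Y + f • lie X Y := by
  have : CompleteSpace E := FiniteDimensional.complete ℝ E
  ext z
  exact mlieBracket_smul_right (f.contMDiff.mdifferentiable (by simp) z) Y.mdifferentiableAt

theorem lie_smul_left (f : SmoothFun I M) (X Y : VField I M) :
    lie (f • X) Y = -(dirDeriv Y f • X) + f • lie X Y := by
  rw [lie_swap, lie_smul_right, lie_swap Y X, smul_neg]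
  abel

/-- The Frölicher–Nijenhuis bracket `[X, K]` of a vector field and a vector 1-form, that is the
Lie derivative of `K`: `[X, K] Y = [X, K Y] - K [X, Y]`. -/
def fieldForm (X : VField I M) (K : VForm1 I M) : VForm1 I M where
  toFun Y := lie X (K Y) - K (lie X Y)
  map_add' Y Y' := by
    simp only [map_add, lie_add_right]
    abel
  map_smul' f Y := by
    simp only [map_smul, map_add, lie_smul_right, RingHom.id_apply]
    module

/-- The Frölicher–Nijenhuis bracket `[K, X] = -[X, K]`, so `[K, X] Y = [K Y, X] - K [Y, X]`. -/
def formField (K : VForm1 I M) (X : VField I M) : VForm1 I M := -fieldForm X K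

theorem formField_apply (K : VForm1 I M) (X Y : VField I M) :
    formField K X Y = lie (K Y) X - K (lie Y X) := by
  change -(lie X (K Y) - K (lie X Y)) = _
  rw [lie_swap X, lie_swap X, map_neg]
  abel

/-- The Frölicher–Nijenhuis bracket `[K, N]` of two vector 1-forms:
`[K, N](X, Y) = [K X, N Y] + [N X, K Y] + K N [X, Y] + N K [X, Y]
  - K [N X, Y] - K [X, N Y] - N [K X, Y] - N [X, K Y]`. -/
def formForm (K N : VForm1 I M) : VForm2 I M :=
  ⟨LinearMap.mk₂ (SmoothFun I M)
    (fun X Y => lie (K X) (N Y) + lie (N X) (K Y) + K (N (lie X Y)) + N (K (lie X Y))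
      - K (lie (N X) Y) - K (lie X (N Y)) - N (lie (K X) Y) - N (lie X (K Y)))
    (fun X X' Y => by simp only [map_add, lie_add_left]; abel)
    (fun f X Y => by
      simp only [map_add, map_smul, map_neg, lie_smul_left]
      module)
    (fun X Y Y' => by simp only [map_add, lie_add_right]; abel)
    (fun f X Y => by
      simp only [map_add, map_smul, lie_smul_right]
      module),
  fun X => by
    simp only [LinearMap.mk₂_apply, lie_self, map_zero]
    rw [lie_swap (N X) (K X), lie_swap (N X) X, lie_swap (K X) X, map_neg, map_neg]
    abel⟩

end Brackets

section Structures

variable {E : Type*} [NormedAddCommGroup E] [NormedSpace ℝ E] [FiniteDimensional ℝ E]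
  {H : Type*} [TopologicalSpace H] {I : ModelWithCorners ℝ E H}
  {M : Type*} [TopologicalSpace M] [ChartedSpace H M] [IsManifold I ∞ M] [T2Space M]

/-- `L` is a vector 1-form of constant rank `n ≥ 1` with `[L, L] = 0` whose image is its kernel at
every point (so that `M` has dimension `2 n`). -/
structure IsIntegrableAlmostTangent (n : ℕ) (L : VForm1 I M) : Prop where
  one_le : 1 ≤ n
  rank_eq : ∀ z, finrank ℝ (LinearMap.range (valueAt L z)) = n
  bracket_self : formForm L L = 0
  range_eq_ker : ∀ z, LinearMap.range (valueAt L z) = LinearMap.ker (valueAt L z)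

/-- The coordinates `(x, y)` given by a chart `φ` and a linear splitting `e` of the model space. -/
def coords {n : ℕ} (φ : OpenPartialHomeomorph M H) (e : E ≃L[ℝ] (Fin n → ℝ) × (Fin n → ℝ)) :
    M → (Fin n → ℝ) × (Fin n → ℝ) :=
  fun z => e (φ.extend I z)

/-- The components `(a, b)` of a tangent vector `v = aⁱ ∂/∂xⁱ + bⁱ ∂/∂yⁱ` at `z` in the
coordinates `(x, y) = coords φ e`. -/
def components {n : ℕ} (φ : OpenPartialHomeomorph M H)
    (e : E ≃L[ℝ] (Fin n → ℝ) × (Fin n → ℝ)) (z : M) (v : TangentSpace I z) :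
    (Fin n → ℝ) × (Fin n → ℝ) :=
  mfderiv I 𝓘(ℝ, (Fin n → ℝ) × (Fin n → ℝ)) (coords (I := I) φ e) z v

/-- `(x, y) = coords φ e` are smooth coordinates in which `L (∂/∂xⁱ) = ∂/∂yⁱ` and
`L (∂/∂yⁱ) = 0`. -/
structure IsNaturalChart {n : ℕ} (L : VForm1 I M) (φ : OpenPartialHomeomorph M H)
    (e : E ≃L[ℝ] (Fin n → ℝ) × (Fin n → ℝ)) : Prop where
  mem_atlas : φ ∈ IsManifold.maximalAtlas I ∞ M
  apply_eq : ∀ z ∈ φ.source, ∀ v : TangentSpace I z,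
    components φ e z (valueAt L z v) = (0, (components φ e z v).1)

/-- `C` is a canonical vector field: around every point there are natural coordinates for `L` in
which `C = yⁱ ∂/∂yⁱ`. -/
def IsCanonicalField (n : ℕ) (L : VForm1 I M) (C : VField I M) : Prop :=
  ∀ z : M, ∃ (φ : OpenPartialHomeomorph M H) (e : E ≃L[ℝ] (Fin n → ℝ) × (Fin n → ℝ)),
    IsNaturalChart L φ e ∧ z ∈ φ.source ∧
      ∀ w ∈ φ.source, components φ e w (C w) = (0, (coords (I := I) φ e w).2)

end Structures

section Connections

variable {E : Type*} [NormedAddCommGroup E] [NormedSpace ℝ E] [FiniteDimensional ℝ E]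
  {H : Type*} [TopologicalSpace H] {I : ModelWithCorners ℝ E H}
  {M : Type*} [TopologicalSpace M] [ChartedSpace H M] [IsManifold I ∞ M]

/-- `S` is an `L`-semispray: `L S = C`. -/
def IsSemispray (L : VForm1 I M) (C S : VField I M) : Prop := L S = C

/-- `K` is an `L`-semibasic vector 1-form: `L K = 0` and `i_X K = 0` for every vector field `X`
in the kernel of `L`. -/
def IsSemibasic (L K : VForm1 I M) : Prop :=
  L ∘ₗ K = 0 ∧ ∀ X : VField I M, L X = 0 → K X = 0

/-- `B` is an `L`-semibasic vector 2-form. -/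
def IsSemibasic2 (L : VForm1 I M) (B : VForm2 I M) : Prop :=
  (∀ X Y, L (B.1 X Y) = 0) ∧ ∀ X : VField I M, L X = 0 → B.1 X = 0

/-- An arbitrarily chosen `L`-semispray (a junk value if there is none). -/
def someSemispray (L : VForm1 I M) (C : VField I M) : VField I M :=
  Classical.epsilon (IsSemispray L C)

/-- The potential `K° = i_S K = K S` of an `L`-semibasic vector 1-form, for an arbitrary
`L`-semispray `S`. -/
def potential (L : VForm1 I M) (C : VField I M) (K : VForm1 I M) : VField I M :=
  K (someSemispray L C)

/-- The potential `B° = i_S B = B(S, ·)` of an `L`-semibasic vector 2-form, for an arbitrary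
`L`-semispray `S`. -/
def potential2 (L : VForm1 I M) (C : VField I M) (B : VForm2 I M) : VForm1 I M :=
  B.1 (someSemispray L C)

/-- The potential does not depend on the semispray. -/
theorem potential_eq {L K : VForm1 I M} {C S : VField I M} (hK : IsSemibasic L K)
    (hS : IsSemispray L C S) : potential L C K = K S := by
  have h : L (someSemispray L C - S) = 0 := by
    rw [map_sub, sub_eq_zero]
    exact (Classical.epsilon_spec (p := IsSemispray L C) ⟨S, hS⟩).trans (Eq.symm hS)
  have h' := hK.2 _ h
  rwa [map_sub, sub_eq_zero] at h'

/-- The potential does not depend on the semispray. -/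
theorem potential2_eq {L : VForm1 I M} {B : VForm2 I M} {C S : VField I M}
    (hB : IsSemibasic2 L B) (hS : IsSemispray L C S) : potential2 L C B = B.1 S := by
  have h : L (someSemispray L C - S) = 0 := by
    rw [map_sub, sub_eq_zero]
    exact (Classical.epsilon_spec (p := IsSemispray L C) ⟨S, hS⟩).trans (Eq.symm hS)
  have h' := hB.2 _ h
  rwa [map_sub, sub_eq_zero] at h'

/-- `Γ` is an `L`-connection: `L Γ = L` and `Γ L = -L`. -/
def IsLConnection (L Γ : VForm1 I M) : Prop :=
  L ∘ₗ Γ = L ∧ Γ ∘ₗ L = -L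

/-- The horizontal projector `h = (I + Γ) / 2` of an `L`-connection. -/
def horizontal (Γ : VForm1 I M) : VForm1 I M :=
  (1 / 2 : ℝ) • (LinearMap.id + Γ)

/-- `S` is the canonical `L`-semispray of the `L`-connection `Γ`: the `L`-semispray `S = h S'`,
where `S'` is an arbitrary `L`-semispray. -/
def IsCanonicalSemispray (L : VForm1 I M) (C : VField I M) (Γ : VForm1 I M)
    (S : VField I M) : Prop :=
  IsSemispray L C S ∧ ∀ S', IsSemispray L C S' → S = horizontal Γ S'

/-- The torsion `T = [L, Γ] / 2`. -/
def torsion (L Γ : VForm1 I M) : VForm2 I M :=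
  (1 / 2 : ℝ) • formForm L Γ

/-- The strong torsion `t = T° - [C, Γ] / 2`. -/
def strongTorsion (L : VForm1 I M) (C : VField I M) (Γ : VForm1 I M) : VForm1 I M :=
  potential2 L C (torsion L Γ) - (1 / 2 : ℝ) • fieldForm C Γ

end Connections

end LConnection
end

namespace LConnection

theorem two_le_infty : (2 : WithTop ℕ∞) ≤ ∞ := WithTop.coe_le_coe.2 (le_top : (2 : ℕ∞) ≤ ⊤)

/-- On a normed space, the Lie bracket of the manifold structure is the usual one. -/
theorem mlieBracket_eq_lieBracket {F : Type*} [NormedAddCommGroup F] [NormedSpace ℝ F]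
    {V W : ∀ x : F, TangentSpace 𝓘(ℝ, F) x} :
    mlieBracket 𝓘(ℝ, F) V W = lieBracket ℝ V W := by
  rw [← mlieBracketWithin_univ, mlieBracketWithin_eq_lieBracketWithin]
  exact lieBracketWithin_univ

section NaturalChart

variable {E : Type*} [NormedAddCommGroup E] [NormedSpace ℝ E]
  {H : Type*} [TopologicalSpace H] {I : ModelWithCorners ℝ E H}
  {M : Type*} [TopologicalSpace M] {n : ℕ}

/-- The inverse of the coordinates `coords φ e`. -/
noncomputable def coordsSymm (I : ModelWithCorners ℝ E H) (φ : OpenPartialHomeomorph M H)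
    (e : E ≃L[ℝ] (Fin n → ℝ) × (Fin n → ℝ)) : (Fin n → ℝ) × (Fin n → ℝ) → M :=
  fun p => (φ.extend I).symm (e.symm p)

/-- The range of the coordinates `coords φ e`. -/
def coordsTarget (I : ModelWithCorners ℝ E H) (φ : OpenPartialHomeomorph M H)
    (e : E ≃L[ℝ] (Fin n → ℝ) × (Fin n → ℝ)) : Set ((Fin n → ℝ) × (Fin n → ℝ)) :=
  e.symm ⁻¹' (φ.extend I).target

variable {φ : OpenPartialHomeomorph M H} {e : E ≃L[ℝ] (Fin n → ℝ) × (Fin n → ℝ)}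

theorem isOpen_coordsTarget [I.Boundaryless] : IsOpen (coordsTarget I φ e) :=
  φ.isOpen_extend_target.preimage e.symm.continuous

theorem coordsSymm_mem_source {p : (Fin n → ℝ) × (Fin n → ℝ)} (hp : p ∈ coordsTarget I φ e) :
    coordsSymm I φ e p ∈ φ.source := by
  rw [← φ.extend_source (I := I)]
  exact (φ.extend I).map_target hp

theorem coords_coordsSymm {p : (Fin n → ℝ) × (Fin n → ℝ)} (hp : p ∈ coordsTarget I φ e) :
    coords (I := I) φ e (coordsSymm I φ e p) = p := by
  simp only [coords, coordsSymm]
  rw [(φ.extend I).right_inv hp, e.apply_symm_apply]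

theorem coordsSymm_coords {z : M} (hz : z ∈ φ.source) :
    coordsSymm I φ e (coords (I := I) φ e z) = z := by
  simp only [coords, coordsSymm, e.symm_apply_apply]
  exact φ.extend_left_inv hz

theorem coords_mem_coordsTarget {z : M} (hz : z ∈ φ.source) :
    coords (I := I) φ e z ∈ coordsTarget I φ e := by
  simp only [coords, coordsTarget, Set.mem_preimage, e.symm_apply_apply]
  exact (φ.extend I).map_source (by rwa [φ.extend_source])

variable [ChartedSpace H M]

theorem contMDiffAt_coords (hφ : φ ∈ IsManifold.maximalAtlas I ∞ M) {z : M} (hz : z ∈ φ.source) :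
    ContMDiffAt I 𝓘(ℝ, (Fin n → ℝ) × (Fin n → ℝ)) ∞ (coords (I := I) φ e) z :=
  e.contDiff.contMDiff.contMDiffAt.comp z
    ((φ.contMDiffOn_extend hφ).contMDiffAt (φ.open_source.mem_nhds hz))

theorem contMDiffAt_coordsSymm [I.Boundaryless] (hφ : φ ∈ IsManifold.maximalAtlas I ∞ M)
    {p : (Fin n → ℝ) × (Fin n → ℝ)} (hp : p ∈ coordsTarget I φ e) :
    ContMDiffAt 𝓘(ℝ, (Fin n → ℝ) × (Fin n → ℝ)) I ∞ (coordsSymm I φ e) p := by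
  have h := contMDiffOn_extend_symm hφ
  rw [← φ.extend_target'] at h
  exact (h.contMDiffAt (φ.isOpen_extend_target.mem_nhds hp)).comp p
    e.symm.contDiff.contMDiff.contMDiffAt

/-- The components of `X` as a function of the coordinates. -/
noncomputable def localRep (φ : OpenPartialHomeomorph M H)
    (e : E ≃L[ℝ] (Fin n → ℝ) × (Fin n → ℝ)) (X : ∀ z : M, TangentSpace I z) :
    (Fin n → ℝ) × (Fin n → ℝ) → (Fin n → ℝ) × (Fin n → ℝ) :=
  fun p => components φ e (coordsSymm I φ e p) (X (coordsSymm I φ e p))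

theorem localRep_coords {z : M} (hz : z ∈ φ.source) (X : ∀ z : M, TangentSpace I z) :
    localRep φ e X (coords (I := I) φ e z) = components φ e z (X z) := by
  exact congrArg (fun w => components φ e w (X w)) (coordsSymm_coords hz)

variable [I.Boundaryless]

theorem mfderiv_coords_comp_mfderiv_coordsSymm (hφ : φ ∈ IsManifold.maximalAtlas I ∞ M)
    {p : (Fin n → ℝ) × (Fin n → ℝ)} (hp : p ∈ coordsTarget I φ e) :
    (mfderiv I 𝓘(ℝ, (Fin n → ℝ) × (Fin n → ℝ)) (coords (I := I) φ e) (coordsSymm I φ e p)).comp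
      (mfderiv 𝓘(ℝ, (Fin n → ℝ) × (Fin n → ℝ)) I (coordsSymm I φ e) p) =
    ContinuousLinearMap.id ℝ _ := by
  rw [← mfderiv_comp p
    ((contMDiffAt_coords hφ (coordsSymm_mem_source hp)).mdifferentiableAt (by simp))
    ((contMDiffAt_coordsSymm hφ hp).mdifferentiableAt (by simp))]
  rw [Filter.EventuallyEq.mfderiv_eq (f := id)]
  · exact mfderiv_id
  · filter_upwards [isOpen_coordsTarget.mem_nhds hp] with q hq
    exact coords_coordsSymm hq

theorem mfderiv_coordsSymm_comp_mfderiv_coords (hφ : φ ∈ IsManifold.maximalAtlas I ∞ M)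
    {z : M} (hz : z ∈ φ.source) :
    (mfderiv 𝓘(ℝ, (Fin n → ℝ) × (Fin n → ℝ)) I (coordsSymm I φ e) (coords (I := I) φ e z)).comp
      (mfderiv I 𝓘(ℝ, (Fin n → ℝ) × (Fin n → ℝ)) (coords (I := I) φ e) z) =
    ContinuousLinearMap.id ℝ _ := by
  rw [← mfderiv_comp z
    ((contMDiffAt_coordsSymm hφ (coords_mem_coordsTarget hz)).mdifferentiableAt (by simp))
    ((contMDiffAt_coords hφ hz).mdifferentiableAt (by simp))]
  rw [Filter.EventuallyEq.mfderiv_eq (f := id)]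
  · exact mfderiv_id
  · filter_upwards [φ.open_source.mem_nhds hz] with q hq
    exact coordsSymm_coords hq

theorem components_injective (hφ : φ ∈ IsManifold.maximalAtlas I ∞ M) {z : M}
    (hz : z ∈ φ.source) : Function.Injective (components (I := I) φ e z) := by
  refine Function.LeftInverse.injective (g := mfderiv 𝓘(ℝ, (Fin n → ℝ) × (Fin n → ℝ)) I
    (coordsSymm I φ e) (coords (I := I) φ e z)) fun v => ?_
  exact DFunLike.congr_fun (mfderiv_coordsSymm_comp_mfderiv_coords hφ hz) v

theorem isInvertible_mfderiv_coordsSymm (hφ : φ ∈ IsManifold.maximalAtlas I ∞ M)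
    {p : (Fin n → ℝ) × (Fin n → ℝ)} (hp : p ∈ coordsTarget I φ e) :
    (mfderiv 𝓘(ℝ, (Fin n → ℝ) × (Fin n → ℝ)) I (coordsSymm I φ e) p).IsInvertible := by
  have h := mfderiv_coordsSymm_comp_mfderiv_coords (e := e) hφ (coordsSymm_mem_source hp)
  rw [coords_coordsSymm hp] at h
  exact .of_inverse h (mfderiv_coords_comp_mfderiv_coordsSymm hφ hp)

variable [IsManifold I ∞ M]

theorem mpullback_coordsSymm (hφ : φ ∈ IsManifold.maximalAtlas I ∞ M)
    {p : (Fin n → ℝ) × (Fin n → ℝ)} (hp : p ∈ coordsTarget I φ e) (X : VField I M) :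
    mpullback 𝓘(ℝ, (Fin n → ℝ) × (Fin n → ℝ)) I (coordsSymm I φ e) X p = localRep φ e X p := by
  have h := mfderiv_coordsSymm_comp_mfderiv_coords (e := e) hφ (coordsSymm_mem_source hp)
  rw [coords_coordsSymm hp] at h
  rw [mpullback_apply, ContinuousLinearMap.inverse_eq h
    (mfderiv_coords_comp_mfderiv_coordsSymm hφ hp)]
  rfl

variable [FiniteDimensional ℝ E]

theorem differentiableAt_localRep (hφ : φ ∈ IsManifold.maximalAtlas I ∞ M)
    {p : (Fin n → ℝ) × (Fin n → ℝ)} (hp : p ∈ coordsTarget I φ e) (X : VField I M) :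
    DifferentiableAt ℝ (localRep φ e X) p := by
  have : CompleteSpace E := FiniteDimensional.complete ℝ E
  have : IsManifold I 2 M := .of_le (n := ∞) two_le_infty
  have h := MDifferentiableAt.mpullback_vectorField (n := 2)
    (X.mdifferentiableAt (x := coordsSymm I φ e p))
    ((contMDiffAt_coordsSymm hφ hp).of_le two_le_infty) (isInvertible_mfderiv_coordsSymm hφ hp) le_rfl
  have hsnd := ((contMDiff_snd_tangentBundle_modelSpace ((Fin n → ℝ) × (Fin n → ℝ))
    𝓘(ℝ, (Fin n → ℝ) × (Fin n → ℝ)) (n := 1)).mdifferentiable one_ne_zero _).comp p h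
  refine hsnd.differentiableAt.congr_of_eventuallyEq ?_
  filter_upwards [isOpen_coordsTarget.mem_nhds hp] with q hq
  exact (mpullback_coordsSymm hφ hq X).symm

/-- The Lie bracket in coordinates. -/
theorem components_lie (hφ : φ ∈ IsManifold.maximalAtlas I ∞ M) {z : M} (hz : z ∈ φ.source)
    (X Y : VField I M) :
    components φ e z (lie X Y z) =
      lieBracket ℝ (localRep φ e X) (localRep φ e Y) (coords (I := I) φ e z) := by
  have : CompleteSpace E := FiniteDimensional.complete ℝ E
  have h2 : IsManifold I 2 M := .of_le (n := ∞) two_le_infty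
  have : IsManifold I (minSmoothness ℝ 2) M := by simpa using h2
  have hp := coords_mem_coordsTarget (I := I) (e := e) hz
  have h := mpullback_mlieBracket (n := 2) X.mdifferentiableAt Y.mdifferentiableAt
    ((contMDiffAt_coordsSymm hφ hp).of_le two_le_infty) (by simp)
  rw [← localRep_coords hz, ← mpullback_coordsSymm hφ hp]
  refine h.trans ?_
  have hev : ∀ X : VField I M,
      mpullback 𝓘(ℝ, (Fin n → ℝ) × (Fin n → ℝ)) I (coordsSymm I φ e) X
        =ᶠ[nhds (coords (I := I) φ e z)] localRep φ e X := fun X => by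
    filter_upwards [isOpen_coordsTarget.mem_nhds hp] with q hq
    exact mpullback_coordsSymm hφ hq X
  rw [Filter.EventuallyEq.mlieBracket_vectorField_eq (hev X) (hev Y)]
  exact congrFun mlieBracket_eq_lieBracket _

end NaturalChart

section Basic

variable {E : Type*} [NormedAddCommGroup E] [NormedSpace ℝ E]
  {H : Type*} [TopologicalSpace H] {I : ModelWithCorners ℝ E H}
  {M : Type*} [TopologicalSpace M] [ChartedSpace H M] [IsManifold I ∞ M]

theorem horizontal_apply (Γ : VForm1 I M) (X : VField I M) :
    horizontal Γ X = (1 / 2 : ℝ) • (X + Γ X) := rfl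

variable [FiniteDimensional ℝ E]

theorem lie_zero_right (X : VField I M) : lie X 0 = 0 := by
  simpa using lie_add_right X 0 0

theorem lie_neg_right (X Y : VField I M) : lie X (-Y) = -lie X Y := by
  rw [eq_neg_iff_add_eq_zero, ← lie_add_right, neg_add_cancel, lie_zero_right]

theorem lie_neg_left (X Y : VField I M) : lie (-X) Y = -lie X Y := by
  rw [lie_swap, lie_neg_right, lie_swap X, neg_neg]

theorem lie_real_smul_left (r : ℝ) (X Y : VField I M) : lie (r • X) Y = r • lie X Y := by
  have : CompleteSpace E := FiniteDimensional.complete ℝ E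
  ext z
  exact mlieBracket_const_smul_left X.mdifferentiableAt

end Basic

section Algebra

variable {E : Type*} [NormedAddCommGroup E] [NormedSpace ℝ E] [FiniteDimensional ℝ E]
  {H : Type*} [TopologicalSpace H] {I : ModelWithCorners ℝ E H}
  {M : Type*} [TopologicalSpace M] [ChartedSpace H M] [IsManifold I ∞ M] [T2Space M]
  {n : ℕ} {L : VForm1 I M}

theorem IsIntegrableAlmostTangent.apply_apply (hL : IsIntegrableAlmostTangent n L)
    (X : VField I M) : L (L X) = 0 := by
  ext z
  have h : valueAt L z (X z) ∈ LinearMap.ker (valueAt L z) :=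
    hL.range_eq_ker z ▸ LinearMap.mem_range_self _ _
  rwa [LinearMap.mem_ker, valueAt_apply, valueAt_apply] at h

/-- Vector 1-forms which agree on the image of `L` agree on its kernel. -/
theorem IsIntegrableAlmostTangent.apply_eq_of_comp_eq (hL : IsIntegrableAlmostTangent n L)
    {K N : VForm1 I M} (h : K ∘ₗ L = N ∘ₗ L) {V : VField I M} (hV : L V = 0) : K V = N V := by
  ext z
  have hz : V z ∈ LinearMap.range (valueAt L z) := by
    rw [hL.range_eq_ker, LinearMap.mem_ker, valueAt_apply, hV]
    rfl
  obtain ⟨v, hv⟩ := hz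
  obtain ⟨X, rfl⟩ := exists_field_eq z v
  rw [valueAt_apply] at hv
  rw [apply_congr K hv.symm, apply_congr N hv.symm]
  exact congrArg (fun Y : VField I M => Y z) (LinearMap.congr_fun h X)

/-- An `L`-connection is `-1` on vertical fields. -/
theorem IsLConnection.apply_vertical {Γ : VForm1 I M} (hΓ : IsLConnection L Γ)
    (hL : IsIntegrableAlmostTangent n L) {V : VField I M} (hV : L V = 0) : Γ V = -V :=
  hL.apply_eq_of_comp_eq (N := -LinearMap.id) (hΓ.2.trans (by ext1 X; rfl)) hV

end Algebra

section Torsion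

variable {E : Type*} [NormedAddCommGroup E] [NormedSpace ℝ E] [FiniteDimensional ℝ E]
  {H : Type*} [TopologicalSpace H] {I : ModelWithCorners ℝ E H}
  {M : Type*} [TopologicalSpace M] [ChartedSpace H M] [IsManifold I ∞ M] [T2Space M]
  {n : ℕ} {L : VForm1 I M} {C S : VField I M}

theorem IsNaturalChart.localRep_apply {φ : OpenPartialHomeomorph M H}
    {e : E ≃L[ℝ] (Fin n → ℝ) × (Fin n → ℝ)} (hφ : IsNaturalChart L φ e)
    {p : (Fin n → ℝ) × (Fin n → ℝ)} (hp : p ∈ coordsTarget I φ e) (X : VField I M) :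
    localRep φ e (L X) p = (0, (localRep φ e X p).1) := by
  have h := hφ.apply_eq _ (coordsSymm_mem_source hp) (X _)
  rwa [valueAt_apply] at h

variable [I.Boundaryless]

theorem IsCanonicalField.apply_lie_apply (hC : IsCanonicalField n L C) (hS : IsSemispray L C S)
    (Y : VField I M) : L (lie S (L Y)) = -L Y := by
  ext z
  obtain ⟨φ, e, hφ, hz, hCφ⟩ := hC z
  refine components_injective (e := e) hφ.mem_atlas hz ?_
  have hp := coords_mem_coordsTarget (I := I) (e := e) hz
  have hnhds := isOpen_coordsTarget.mem_nhds hp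
  have hneg : components φ e z ((-L Y) z) = -components φ e z ((L Y) z) :=
    map_neg (mfderiv I 𝓘(ℝ, (Fin n → ℝ) × (Fin n → ℝ)) (coords (I := I) φ e) z) _
  rw [hneg, ← valueAt_apply, hφ.apply_eq z hz, ← valueAt_apply L Y, hφ.apply_eq z hz,
    components_lie hφ.mem_atlas hz, lieBracket_eq]
  have hSfst : (fun p => (localRep φ e S p).1) =ᶠ[nhds (coords (I := I) φ e z)] Prod.snd := by
    filter_upwards [hnhds] with p hp
    have h1 := hφ.localRep_apply hp S
    have h2 := hCφ _ (coordsSymm_mem_source hp)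
    rw [hS] at h1
    rw [coords_coordsSymm hp] at h2
    exact (congrArg Prod.snd (h1.symm.trans h2))
  have hLYfst : (fun p => (localRep φ e (L Y) p).1) =ᶠ[nhds (coords (I := I) φ e z)]
      fun _ => 0 := by
    filter_upwards [hnhds] with p hp
    rw [hφ.localRep_apply hp]
  have h1 := (differentiableAt_localRep hφ.mem_atlas hp S).hasFDerivAt.fst.unique
    (hasFDerivAt_snd.congr_of_eventuallyEq hSfst)
  have h2 := (differentiableAt_localRep hφ.mem_atlas hp (L Y)).hasFDerivAt.fst.unique
    ((hasFDerivAt_const _ _).congr_of_eventuallyEq hLYfst)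
  refine Prod.ext (by simp) ?_
  have h1' := DFunLike.congr_fun h1 (localRep φ e (L Y) (coords (I := I) φ e z))
  have h2' := DFunLike.congr_fun h2 (localRep φ e S (coords (I := I) φ e z))
  simp only [ContinuousLinearMap.comp_apply, ContinuousLinearMap.coe_fst',
    ContinuousLinearMap.coe_snd', zero_apply] at h1' h2'
  rw [hφ.localRep_apply hp, localRep_coords hz] at h1'
  rw [Prod.snd_neg, Prod.fst_sub, h2', hφ.localRep_apply hp, localRep_coords hz, h1', zero_sub]

theorem IsCanonicalField.apply_lie_vertical (hC : IsCanonicalField n L C)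
    (hL : IsIntegrableAlmostTangent n L) (hS : IsSemispray L C S)
    {V : VField I M} (hV : L V = 0) : L (lie S V) = -V := by
  have h := hL.apply_eq_of_comp_eq (K := fieldForm S L) (N := LinearMap.id) (V := V) (by
    ext1 Y
    change lie S (L (L Y)) - L (lie S (L Y)) = L Y
    rw [hL.apply_apply, hC.apply_lie_apply hS, lie_zero_right, zero_sub, neg_neg]) hV
  change lie S (L V) - L (lie S V) = V at h
  rw [hV, lie_zero_right, zero_sub] at h
  exact neg_eq_iff_eq_neg.1 h

/-- The strong torsion measures the deviation of an `L`-connection from `[L, S]`, where `S` is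
its canonical semispray. -/
theorem strongTorsion_eq (hL : IsIntegrableAlmostTangent n L) (hC : IsCanonicalField n L C)
    {Γ : VForm1 I M} (hΓ : IsLConnection L Γ) (hS : IsCanonicalSemispray L C Γ S) :
    strongTorsion L C Γ = Γ - formField L S := by
  obtain ⟨hS, hcan⟩ := hS
  have hS' : IsSemispray L C (someSemispray L C) := Classical.epsilon_spec ⟨S, hS⟩
  ext1 Y
  change (1 / 2 : ℝ) • (formForm L Γ).1 (someSemispray L C) Y - (1 / 2 : ℝ) • fieldForm C Γ Y =
    Γ Y - formField L S Y
  rw [formField_apply]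
  generalize someSemispray L C = S' at hS'
  have hΓS' : Γ S' = (2 : ℝ) • S + -S' := by
    rw [hcan S' hS', horizontal_apply]
    module
  have hLΓ : ∀ X, L (Γ X) = L X := LinearMap.congr_fun hΓ.1
  have hΓL : ∀ X, Γ (L X) = -L X := LinearMap.congr_fun hΓ.2
  have hv : L (lie S' (Γ Y)) = L (lie S' Y) - Γ Y + Y := by
    have h := hC.apply_lie_vertical hL hS' (V := Γ Y + -Y) (by rw [map_add, hLΓ, map_neg]; abel)
    rw [lie_add_right, lie_neg_right, map_add, map_neg] at h
    linear_combination (norm := module) h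
  have hh : Γ (lie S' (L Y)) = -lie S' (L Y) - Y - Γ Y := by
    have h := hΓ.apply_vertical hL (V := lie S' (L Y) + Y)
      (by rw [map_add, hC.apply_lie_apply hS']; abel)
    rw [map_add] at h
    linear_combination (norm := module) h
  have hform : (formForm L Γ).1 S' Y = lie (L S') (Γ Y) + lie (Γ S') (L Y) + L (Γ (lie S' Y))
      + Γ (L (lie S' Y)) - L (lie (Γ S') Y) - L (lie S' (Γ Y)) - Γ (lie (L S') Y)
      - Γ (lie S' (L Y)) := rfl
  have hfield : fieldForm C Γ Y = lie C (Γ Y) - Γ (lie C Y) := rfl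
  have hLreal : ∀ (r : ℝ) (X : VField I M), L (r • X) = r • L X :=
    (L.restrictScalars ℝ).map_smul
  rw [hform, hfield, hLΓ, hΓL, hv, hh, hΓS', show L S' = C from hS', lie_add_left, lie_add_left,
    lie_real_smul_left, lie_real_smul_left, lie_neg_left, lie_neg_left, map_add, map_neg, hLreal,
    lie_swap (L Y) S, lie_swap Y S, map_neg]
  module

theorem formField_add_isLConnection (hL : IsIntegrableAlmostTangent n L)
    (hC : IsCanonicalField n L C) (hS : IsSemispray L C S) {t : VForm1 I M}
    (ht : IsSemibasic L t) : IsLConnection L (formField L S + t) := by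
  constructor
  · ext1 Y
    change L (formField L S Y + t Y) = L Y
    have h : L (t Y) = 0 := LinearMap.congr_fun ht.1 Y
    rw [formField_apply, map_add, map_sub, hL.apply_apply, h, lie_swap, map_neg,
      hC.apply_lie_apply hS]
    abel
  · ext1 Y
    change formField L S (L Y) + t (L Y) = -L Y
    rw [formField_apply, hL.apply_apply, ht.2 _ (hL.apply_apply Y), lie_swap 0, lie_zero_right,
      lie_swap, map_neg, hC.apply_lie_apply hS]
    abel

theorem formField_add_isCanonicalSemispray (hL : IsIntegrableAlmostTangent n L)
    (hC : IsCanonicalField n L C) (hS : IsSemispray L C S) {t : VForm1 I M}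
    (ht : IsSemibasic L t) (hSt : potential L C t + lie C S - S = 0) :
    IsCanonicalSemispray L C (formField L S + t) S := by
  refine ⟨hS, fun S' hS' => ?_⟩
  have hΓS : (formField L S + t) S = S := by
    change formField L S S + t S = S
    rw [potential_eq ht hS, sub_eq_zero] at hSt
    rw [formField_apply, lie_self, map_zero, sub_zero, show L S = C from hS, add_comm, hSt]
  have hv := (formField_add_isLConnection hL hC hS ht).apply_vertical hL (V := S' - S) (by
    rw [map_sub, show L S' = C from hS', show L S = C from hS, sub_self])
  rw [map_sub, hΓS, sub_eq_iff_eq_add] at hv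
  rw [horizontal_apply, hv]
  module

end Torsion

end LConnection

open LConnection in
theorem theorem3 {E : Type*} [NormedAddCommGroup E] [NormedSpace ℝ E] [FiniteDimensional ℝ E]
    {H : Type*} [TopologicalSpace H] (I : ModelWithCorners ℝ E H) [I.Boundaryless]
    (M : Type*) [TopologicalSpace M] [ChartedSpace H M] [IsManifold I ∞ M]
    [T2Space M] [ParacompactSpace M]
    (n : ℕ) (L : VForm1 I M) (hL : IsIntegrableAlmostTangent n L)
    (C : VField I M) (hC : IsCanonicalField n L C)
    (S : VField I M) (hS : IsSemispray L C S)
    (t : VForm1 I M) (ht : IsSemibasic L t)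
    (hSt : potential L C t + lie C S - S = 0) :
    (∃! Γ : VForm1 I M,
      IsLConnection L Γ ∧ IsCanonicalSemispray L C Γ S ∧ strongTorsion L C Γ = t) ∧
    (IsLConnection L (formField L S + t) ∧ IsCanonicalSemispray L C (formField L S + t) S ∧
      strongTorsion L C (formField L S + t) = t) := by
  have hΓ := formField_add_isLConnection hL hC hS ht
  have hcan := formField_add_isCanonicalSemispray hL hC hS ht hSt
  have htor : strongTorsion L C (formField L S + t) = t := by
    rw [strongTorsion_eq hL hC hΓ hcan, add_sub_cancel_left]
  refine ⟨⟨formField L S + t, ⟨hΓ, hcan, htor⟩, ?_⟩, hΓ, hcan, htor⟩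
  rintro Γ ⟨hΓ', hcan', rfl⟩
  rw [strongTorsion_eq hL hC hΓ' hcan', add_sub_cancel]
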